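/- Let $\mathbf{f} = f_0f_1f_2\cdots = 01001010\cdots$ be the infinite Fibonacci word, i.e. the fixed point, starting with $0$, of the morphism $0 \mapsto 01$, $1 \mapsto 0$. Let $T$ be the transducer with states $q_0, q_1$ and initial state $q_0$ that, reading $0$ (resp. $1$) in state $q_0$, outputs $00$ (resp. $0$) and moves to $q_1$, and, reading $0$ (resp. $1$) in state $q_1$, outputs $11$ (resp. $1$) and moves to $q_0$. The Rote-Fibonacci word $\mathbf{r} = 001001101101100100110110\cdots$ is the infinite binary word output by $T$ on input $\mathbf{f}$. For a finite word $x$, let $x^R$ denote its reversal. An infinite binary word avoids the pattern $x x x^R$ if there is no nonempty finite binary word $x$ such that $x x x^R$ occurs as a factor (a block of consecutive letters) of it, and it is aperiodic if it is not ultimately periodic, i.e. if there are no integers $p \geq 1$ and $n \geq 0$ such that its letters at positions $i$ and $i+p$ are equal for all $i \geq n$. Theorem. The Rote-Fibonacci word $\mathbf{r}$ avoids the pattern $x x x^R$, and $\mathbf{r}$ is aperiodic. In particular, there exists an aperiodic infinite binary word avoiding the pattern $x x x^R$. -/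

import Mathlib

namespace RoteFib

/-- The binary alphabet `{0, 1}`. -/
abbrev Letter : Type := Fin 2

/-- Finite binary words. -/
abbrev Word : Type := List Letter

/-- Infinite binary words `w₀ w₁ w₂ ⋯`. -/
abbrev InfWord : Type := ℕ → Letter

/-- The prefix of length `n` of an infinite word. -/
def InfWord.pref (w : InfWord) (n : ℕ) : Word := (List.range n).map w

/-- The finite word `x` is a factor of (occurs as a block of consecutive letters in) `w`. -/
def InfWord.HasFactor (w : InfWord) (x : Word) : Prop :=
  ∃ i : ℕ, (List.range x.length).map (fun t => w (i + t)) = x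

/-- `w` avoids the pattern `x x xᴿ`. -/
def InfWord.AvoidsXXXR (w : InfWord) : Prop :=
  ∀ x : Word, x ≠ [] → ¬ w.HasFactor (x ++ x ++ x.reverse)

/-- `w` is ultimately periodic: some suffix of `w` has a period `p ≥ 1`. -/
def InfWord.UltimatelyPeriodic (w : InfWord) : Prop :=
  ∃ p : ℕ, 1 ≤ p ∧ ∃ n : ℕ, ∀ i : ℕ, n ≤ i → w i = w (i + p)

/-! ### The infinite Fibonacci word -/

/-- The Fibonacci morphism on letters: `0 ↦ 01`, `1 ↦ 0`. -/
def phiLetter : Letter → Word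
  | 0 => [0, 1]
  | 1 => [0]

/-- The Fibonacci morphism on finite words. -/
def phi (x : Word) : Word := x.flatMap phiLetter

/-- The finite Fibonacci words `φⁿ(0)`: `0`, `01`, `010`, `01001`, … -/
def fibFinite (n : ℕ) : Word := phi^[n] [0]

theorem fibFinite_succ (n : ℕ) : fibFinite (n + 1) = phi (fibFinite n) :=
  Function.iterate_succ_apply' phi n [0]

theorem fibFinite_add_two (n : ℕ) : fibFinite (n + 2) = fibFinite (n + 1) ++ fibFinite n := by
  induction n with
  | zero => rfl
  | succ n ih =>
    have h : phi (fibFinite (n + 1) ++ fibFinite n)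
        = phi (fibFinite (n + 1)) ++ phi (fibFinite n) := by simp [phi]
    rw [fibFinite_succ (n + 2), ih, h, ← fibFinite_succ, ← fibFinite_succ, ih]

theorem length_fibFinite (n : ℕ) : n < (fibFinite n).length := by
  have h : n < (fibFinite n).length ∧ n + 1 < (fibFinite (n + 1)).length := by
    induction n with
    | zero => decide
    | succ n ih =>
      refine ⟨ih.2, ?_⟩
      rw [fibFinite_add_two, List.length_append]
      omega
  exact h.1

/-- The infinite Fibonacci word `𝐟 = 01001010⋯`, the fixed point of `φ` starting with `0`, that is,
the limit of the words `φⁿ(0)`, each of which is a prefix of the next. -/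
def fibWord : InfWord := fun n => (fibFinite n)[n]'(length_fibFinite n)

/-! ### The transducer and the Rote–Fibonacci word -/

/-- The two states of the transducer. -/
inductive State : Type
  | q0
  | q1

/-- Every transition changes the state. -/
def State.next : State → State
  | .q0 => .q1
  | .q1 => .q0

/-- The outputs on the transitions: `0/00`, `1/0` from `q0`, and `0/11`, `1/1` from `q1`. -/
def State.output : State → Letter → Word
  | .q0, 0 => [0, 0]
  | .q0, 1 => [0]
  | .q1, 0 => [1, 1]
  | .q1, 1 => [1]

/-- The output of the transducer, started in a given state, on a finite input word. -/
def transduce : State → Word → Word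
  | _, [] => []
  | q, a :: x => q.output a ++ transduce q.next x

theorem length_le_transduce (q : State) (x : Word) : x.length ≤ (transduce q x).length := by
  induction x generalizing q with
  | nil => simp
  | cons a x ih =>
    have h1 : 1 ≤ (q.output a).length := by
      cases q <;> fin_cases a <;> decide
    have h2 := ih q.next
    simp only [transduce, List.length_cons, List.length_append]
    omega

theorem lt_length_transduce (w : InfWord) (q : State) (n : ℕ) :
    n < (transduce q (w.pref (n + 1))).length :=
  lt_of_lt_of_le (by simp [InfWord.pref]) (length_le_transduce q (w.pref (n + 1)))

/-- The output of the transducer on an infinite word. Every input letter produces at least one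
output letter, so the `n`-th output letter (from `n = 0`) is determined by the first `n + 1`
input letters. -/
def transduceInf (q : State) (w : InfWord) : InfWord := fun n =>
  (transduce q (w.pref (n + 1)))[n]'(lt_length_transduce w q n)

/-- The Rote–Fibonacci word `𝐫 = 001001101101100100110110⋯`, the output of the transducer,
started in state `q0`, on the infinite Fibonacci word. -/
def roteFib : InfWord := transduceInf .q0 fibWord

end RoteFib

namespace RoteFib

/-! Letter `k` of 𝐫 is the parity of `⌊(k+2)τ⌋`: the `n`-th transducer output block is exactly the
set of `k` with `⌊(k+2)τ⌋ = n+1`, and the state alternates with `n`.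

Suppose `x x xᴿ` occurs with `|x| = n`, the reversal starting at Beatty index `K`. Let `d = nτ - m`
with `m` the nearest even integer and `E = (2K-1)τ - M` with `M` the nearest odd one. Indices
mirrored about the centre of `x xᴿ` differ by an odd `q < 2n`; for every odd `p`, put `e = qτ - p`.
The palindrome forces `|E| ≤ |e|`, and the square forbids `e` from lying strictly between `E` and `E
- 2d`. An `e` of sign opposite to `d` with `|e| < |d|` violates this (`odd_approx_obstruction`).
Such an `e` exists by expanding `(n, m)` in a basis of consecutive Fibonacci vectors
(`exists_odd_approx`), except in one family, where `e = d/2` also occurs and a weaker bound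
suffices.

Aperiodicity follows from the irrationality of `τ`, since parities determine the increments of
`⌊kτ⌋`. -/

/-- The inverse `(√5 - 1) / 2` of the golden ratio. -/
noncomputable def tau : ℝ := (√5 - 1) / 2

theorem tau_sq : tau ^ 2 = 1 - tau := by
  have h : √5 ^ 2 = 5 := Real.sq_sqrt (by norm_num)
  unfold tau
  nlinarith

theorem lt_tau : 0.618 < tau := by
  have h : (2.236 : ℝ) < √5 := Real.lt_sqrt_of_sq_lt (by norm_num)
  unfold tau
  linarith

theorem tau_lt : tau < 0.6181 := by
  have h : √5 < 2.2362 := by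
    rw [Real.sqrt_lt' (by norm_num)]
    norm_num
  unfold tau
  linarith

theorem irrational_tau : Irrational tau := by
  have h : tau = -Real.goldenConj := by
    unfold tau Real.goldenConj
    ring
  rw [h]
  exact Real.goldenConj_irrational.neg

theorem int_mul_tau_ne {q : ℤ} (hq : q ≠ 0) (p : ℤ) : (q : ℝ) * tau ≠ p :=
  (irrational_tau.intCast_mul hq).ne_int p

/-! ### Rational approximations of `tau` by quotients of odd integers -/

/-- Consecutive Fibonacci numbers `g ≤ f` around `n`, characterised by Cassini's identity. -/
theorem exists_cassini_pair (n : ℕ) (hn : 3 ≤ n) : ∃ f g : ℤ, f ≤ n ∧ (n : ℤ) < f + g ∧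
    f < 2 * g ∧ 4 * g < 3 * f ∧ (f ^ 2 - f * g - g ^ 2 = 1 ∨ f ^ 2 - f * g - g ^ 2 = -1) := by
  induction n, hn using Nat.le_induction with
  | base => exact ⟨3, 2, by norm_num⟩
  | succ n hn ih =>
    obtain ⟨f, g, h1, h2, h3, h4, h5⟩ := ih
    by_cases h : (n : ℤ) + 1 < f + g
    · exact ⟨f, g, by push_cast; omega, by push_cast; omega, h3, h4, h5⟩
    · refine ⟨f + g, f, by push_cast; omega, by push_cast; omega, by omega, by omega, ?_⟩
      rcases h5 with h5 | h5
      · right; linarith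
      · left; linarith

/-- There are odd `q` and `p` such that `q τ - p` has the sign opposite to `d`, and `q` and the
absolute value of `q τ - p` are bounded by `N` and `B`. -/
def HasOddApprox (N : ℤ) (d B : ℝ) : Prop :=
  ∃ q p : ℤ, Odd q ∧ Odd p ∧ 1 ≤ q ∧ q < N ∧ (q * tau - p) * d < 0 ∧ |q * tau - p| < B

/-- Since `τ² = 1 - τ`, the error of `(f+g, f)` is `-τ` times that of `(f, g)`. Hence signs and
sizes of errors are read off from `x - yτ`. -/
theorem HasOddApprox.of_coords {f g N x y : ℤ} {u B : ℝ} (hf : f ≠ 0)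
    (hq : Odd (x * f + y * (f + g))) (hp : Odd (x * g + y * f))
    (h1 : 1 ≤ x * f + y * (f + g)) (h2 : x * f + y * (f + g) < N)
    (hu : (x - y * tau) * u < 0) (hB : |x - y * tau| < B) :
    HasOddApprox N ((f * tau - g) * u) (|f * tau - g| * B) := by
  have ha : (f : ℝ) * tau - g ≠ 0 := sub_ne_zero.2 (int_mul_tau_ne hf g)
  have he : ((x * f + y * (f + g) : ℤ) : ℝ) * tau - ((x * g + y * f : ℤ) : ℝ)
      = (f * tau - g) * (x - y * tau) := by
    push_cast
    linear_combination (-(f : ℝ) * y) * (-tau_sq)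
  refine ⟨_, _, hq, hp, h1, h2, ?_, ?_⟩
  · rw [he]
    have := mul_neg_of_pos_of_neg (sq_pos_of_ne_zero ha) hu
    linarith
  · rw [he, abs_mul]
    exact mul_lt_mul_of_pos_left hB (abs_pos.2 ha)

/-- The second alternative occurs when `(n, m)` is twice an odd pair too good to be beaten: `(2,
2)`, or coordinates `(-2, 2)` below. -/
theorem exists_odd_approx (n : ℕ) (hn : 1 ≤ n) (m : ℤ) (hm : Even m) (hd : |n * tau - m| < 1) :
    HasOddApprox (2 * n) (n * tau - m) |n * tau - m| ∨
    (∃ q p : ℤ, Odd q ∧ Odd p ∧ 1 ≤ q ∧ q < 2 * n ∧ q * tau - p = (n * tau - m) / 2) ∧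
      HasOddApprox (2 * n) (n * tau - m) (3 / 2 * |n * tau - m|) := by
  have t1 := lt_tau
  have t2 := tau_lt
  rw [abs_lt] at hd
  obtain rfl | rfl | hn3 : n = 1 ∨ n = 2 ∨ 3 ≤ n := by omega
  · have h1 : m < 2 := by
      have : (m : ℝ) < 2 := by push_cast at hd; linarith
      exact_mod_cast this
    have h2 : -1 < m := by
      have : (-1 : ℝ) < m := by push_cast at hd; linarith
      exact_mod_cast this
    obtain rfl : m = 0 := by
      obtain ⟨k, rfl⟩ := hm
      omega
    left
    refine ⟨1, 1, by decide, by decide, by norm_num, by norm_num, ?_, ?_⟩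
    · push_cast; nlinarith
    · push_cast
      rw [abs_of_neg (by linarith), abs_of_pos (by linarith)]
      linarith
  · have h1 : m < 3 := by
      have : (m : ℝ) < 3 := by push_cast at hd; linarith
      exact_mod_cast this
    have h2 : 0 < m := by
      have : (0 : ℝ) < m := by push_cast at hd; linarith
      exact_mod_cast this
    obtain rfl : m = 2 := by
      obtain ⟨k, rfl⟩ := hm
      omega
    right
    refine ⟨⟨1, 1, by decide, by decide, by norm_num, by norm_num, by push_cast; ring⟩,
      3, 1, by decide, by decide, by norm_num, by norm_num, ?_, ?_⟩
    · push_cast; nlinarith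
    · push_cast
      rw [abs_of_pos (by linarith), abs_of_neg (by linarith)]
      linarith
  obtain ⟨f, g, hfn, hnf, h3, h4, hdet⟩ := exists_cassini_pair n hn3
  have hf0 : f ≠ 0 := by omega
  -- By Cassini, `(f, g)` and `(f+g, f)` form a basis of `ℤ²`.
  obtain ⟨x, y, hx, hy⟩ : ∃ x y : ℤ, x * f + y * (f + g) = n ∧ x * g + y * f = m := by
    rcases hdet with h | h
    · exact ⟨n * f - m * (f + g), m * f - n * g, by linear_combination (n : ℤ) * h,
        by linear_combination m * h⟩
    · exact ⟨-(n * f - m * (f + g)), -(m * f - n * g), by linear_combination -(n : ℤ) * h,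
        by linear_combination -m * h⟩
  have hδ : (n : ℝ) * tau - m = (f * tau - g) * (x - y * tau) := by
    have hx' : (n : ℝ) = x * f + y * (f + g) := by exact_mod_cast hx.symm
    have hy' : (m : ℝ) = x * g + y * f := by exact_mod_cast hy.symm
    rw [hx', hy']
    linear_combination (-(f : ℝ) * y) * (-tau_sq)
  have hpar : (Odd f ∧ Odd g) ∨ (Odd f ∧ Even g) ∨ (Even f ∧ Odd g) := by
    rcases Int.even_or_odd f with ⟨a, ha⟩ | hf <;> rcases Int.even_or_odd g with ⟨b, hb⟩ | hg
    · exfalso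
      subst ha hb
      have : 2 * (2 * (a ^ 2 - a * b - b ^ 2)) = 1 ∨ 2 * (2 * (a ^ 2 - a * b - b ^ 2)) = -1 := by
        rcases hdet with h | h
        · left; linarith
        · right; linarith
      omega
    · exact .inr (.inr ⟨⟨a, ha⟩, hg⟩)
    · exact .inr (.inl ⟨hf, b, hb⟩)
    · exact .inl ⟨hf, hg⟩
  rw [hδ]
  simp only [abs_mul]
  rw [mul_left_comm (3 / 2 : ℝ)]
  rcases lt_trichotomy y 0 with hy0 | rfl | hy0
  · -- the error of `n` has the sign of that of `f`
    have hxy : 2 - y ≤ x := by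
      by_contra! hlt
      have h5 : x * f ≤ (1 - y) * f := mul_le_mul_of_nonneg_right (by omega) (by omega)
      have h6 : y * g < 0 := mul_neg_of_neg_of_pos hy0 (by omega)
      linarith
    have hxR : (2 : ℝ) - y ≤ x := by exact_mod_cast hxy
    have hyR : (y : ℝ) ≤ -1 := by exact_mod_cast (by omega : y ≤ -1)
    have hpos : 3.618 < (x : ℝ) - y * tau := by nlinarith
    left
    rw [abs_of_pos (by linarith : 0 < (x : ℝ) - y * tau)]
    have key : ∀ x' y' : ℤ, Odd (x' * f + y' * (f + g)) → Odd (x' * g + y' * f) →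
        1 ≤ x' * f + y' * (f + g) → x' * f + y' * (f + g) < 2 * n →
        (x' : ℝ) - y' * tau < 0 → -((x' : ℝ) - y' * tau) < x - y * tau →
        HasOddApprox (2 * n) ((f * tau - g) * (x - y * tau))
          (|f * tau - g| * (x - y * tau)) := fun x' y' a1 a2 a3 a4 a5 a6 =>
      HasOddApprox.of_coords hf0 a1 a2 a3 a4 (mul_neg_of_neg_of_pos a5 (by linarith))
        (by rwa [abs_of_neg a5])
    -- The parities of `f, g` fix the class mod 2 of the witness coordinates: `(1,0)`, `(0,1)` and
    -- `(1,1)` respectively.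
    rcases hpar with ⟨hf, hg⟩ | ⟨hf, hg⟩ | ⟨hf, hg⟩
    · by_cases hx4 : 4 ≤ x
      · have hx4R : (4 : ℝ) ≤ x := by exact_mod_cast hx4
        refine key (-3) 2 ?_ ?_ (by linarith) (by linarith) (by push_cast; linarith)
          (by push_cast; nlinarith)
        · obtain ⟨a, rfl⟩ := hf
          exact ⟨-a + g - 1, by ring⟩
        · obtain ⟨a, rfl⟩ := hg
          exact ⟨-3 * a + f - 2, by ring⟩
      · obtain rfl : x = 3 := by omega
        obtain rfl : y = -1 := by omega
        -- Here `n = 2f - g`, and `q = f + 2g < 2n` is exactly `4g < 3f`.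
        refine key (-1) 2 ?_ ?_ (by linarith) (by linarith) (by push_cast; linarith)
          (by push_cast; linarith)
        · obtain ⟨a, rfl⟩ := hf
          exact ⟨a + g, by ring⟩
        · obtain ⟨a, rfl⟩ := hg
          exact ⟨-a + f - 1, by ring⟩
    · refine key 0 1 ?_ ?_ (by linarith) (by linarith) (by push_cast; linarith)
        (by push_cast; linarith)
      · simpa using hf.add_even hg
      · simpa using hf
    · refine key (-1) 1 ?_ ?_ (by linarith) (by linarith) (by push_cast; linarith)
        (by push_cast; linarith)
      · simpa using hg
      · rw [show -1 * g + 1 * f = f - g by ring]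
        exact hf.sub_odd hg
  · -- `n = f`
    have hx1 : x = 1 := by
      have h5 : 0 < x := by
        by_contra! h
        nlinarith
      have h6 : x < 2 := by
        by_contra! h
        nlinarith
      omega
    subst hx1
    have hg : Even g := by
      rw [← hy] at hm
      simpa using hm
    have hf : Odd f := by
      rcases hpar with ⟨hf, -⟩ | ⟨hf, -⟩ | ⟨-, hg'⟩
      · exact hf
      · exact hf
      · exact absurd hg (Int.not_even_iff_odd.2 hg')
    left
    refine HasOddApprox.of_coords (x := 0) (y := 1) hf0 ?_ ?_ (by linarith) (by linarith)
      (by push_cast; linarith) ?_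
    · simpa using hf.add_even hg
    · simpa using hf
    · push_cast
      rw [abs_of_neg (by linarith), abs_of_pos (by linarith)]
      linarith
  · -- the error of `n` has the sign opposite to that of `f`
    have hxy : x ≤ -y := by
      by_contra! hlt
      have h5 : (1 - y) * f ≤ x * f := mul_le_mul_of_nonneg_right (by omega) (by omega)
      have h6 : 0 ≤ (y - 1) * g := mul_nonneg (by omega) (by omega)
      linarith
    have hy2 : 2 ≤ y := by
      by_contra! hlt
      obtain rfl : y = 1 := by omega
      have h5 : x * f ≤ -1 * f := mul_le_mul_of_nonneg_right (by omega) (by omega)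
      linarith
    have hxR : (x : ℝ) ≤ -y := by exact_mod_cast hxy
    have hyR : (2 : ℝ) ≤ y := by exact_mod_cast hy2
    have hneg : 3.236 ≤ -((x : ℝ) - y * tau) := by nlinarith
    rw [abs_of_neg (by linarith : (x : ℝ) - y * tau < 0)]
    have key : ∀ (x' y' : ℤ) (B : ℝ), Odd (x' * f + y' * (f + g)) → Odd (x' * g + y' * f) →
        1 ≤ x' * f + y' * (f + g) → x' * f + y' * (f + g) < 2 * n →
        0 < (x' : ℝ) - y' * tau → (x' : ℝ) - y' * tau < B →
        HasOddApprox (2 * n) ((f * tau - g) * (x - y * tau))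
          (|f * tau - g| * B) := fun x' y' B a1 a2 a3 a4 a5 a6 =>
      HasOddApprox.of_coords hf0 a1 a2 a3 a4 (mul_neg_of_pos_of_neg a5 (by linarith))
        (by rwa [abs_of_pos a5])
    rcases hpar with ⟨hf, hg⟩ | ⟨hf, hg⟩ | ⟨hf, hg⟩
    · left
      exact key 1 0 _ (by simpa using hf) (by simpa using hg) (by linarith) (by linarith)
        (by push_cast; linarith) (by push_cast; linarith)
    · left
      refine key 2 (-1) _ ?_ ?_ (by linarith) (by linarith) (by push_cast; linarith)
        (by push_cast; linarith)
      · rw [show 2 * f + -1 * (f + g) = f - g by ring]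
        exact hf.sub_even hg
      · obtain ⟨a, rfl⟩ := hf
        exact ⟨g - a - 1, by ring⟩
    · have hq : Odd (3 * f + -1 * (f + g)) := by
        obtain ⟨a, rfl⟩ := hg
        exact ⟨f - a - 1, by ring⟩
      have hp : Odd (3 * g + -1 * f) := by
        obtain ⟨a, rfl⟩ := hg
        obtain ⟨b, rfl⟩ := hf
        exact ⟨3 * a + 1 - b, by ring⟩
      -- The witness `(3, -1)` has size `3 + τ`, which exceeds `2 + 2τ` but not `3/2` of it.
      by_cases h22 : x = -2 ∧ y = 2
      · right
        obtain ⟨rfl, rfl⟩ := h22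
        refine ⟨⟨g, f - g, hg, hf.sub_odd hg, by linarith, by linarith, ?_⟩,
          key 3 (-1) _ hq hp (by linarith) (by linarith) (by push_cast; linarith)
            (by push_cast; linarith)⟩
        push_cast
        linear_combination (f : ℝ) * tau_sq
      · left
        refine key 3 (-1) _ hq hp (by linarith) (by linarith) (by push_cast; linarith) ?_
        push_cast
        by_cases h2 : y = 2
        · subst h2
          have : (x : ℝ) ≤ -3 := by exact_mod_cast (by omega : x ≤ -3)
          push_cast
          linarith
        · have : (3 : ℝ) ≤ y := by exact_mod_cast (by omega : 3 ≤ y)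
          nlinarith

/-- No pair of shifts `E`, `d` is compatible with all odd approximations. -/
theorem odd_approx_obstruction (n : ℕ) (hn : 1 ≤ n) (m : ℤ) (hm : Even m)
    (hd : |n * tau - m| < 1) (E : ℝ)
    (hE : ∀ q p : ℤ, Odd q → Odd p → 1 ≤ q → q < 2 * n →
      |E| ≤ |q * tau - p| ∧ q * tau - p ≠ E ∧
      0 ≤ (q * tau - p - E) * (q * tau - p - (E - 2 * (n * tau - m)))) : False := by
  have happrox := exists_odd_approx n hn m hm hd
  set d := (n : ℝ) * tau - m
  rcases happrox with ⟨q, p, hq, hp, h1, h2, h3, h4⟩ |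
    ⟨⟨q', p', hq', hp', h1', h2', h3'⟩, q, p, hq, hp, h1, h2, h3, h4⟩
  · obtain ⟨a, b, c⟩ := hE q p hq hp h1 h2
    set e := (q : ℝ) * tau - p
    -- For `d < 0`: `E < e` forces `e ≥ E - 2d ≥ -e - 2d`, so `e ≥ |d|`.
    rcases lt_trichotomy d 0 with h0 | h0 | h0
    · have he : 0 < e := by nlinarith
      rw [abs_of_pos he, abs_of_neg h0] at h4
      rw [abs_of_pos he, abs_le] at a
      have : E < e := lt_of_le_of_ne a.2 (Ne.symm b)
      nlinarith
    · rw [h0] at h3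
      simp at h3
    · have he : e < 0 := by nlinarith
      rw [abs_of_neg he, abs_of_pos h0] at h4
      rw [abs_of_neg he, abs_le] at a
      have : e < E := lt_of_le_of_ne (by linarith) b
      nlinarith
  · obtain ⟨a, b, c⟩ := hE q p hq hp h1 h2
    obtain ⟨a', b', c'⟩ := hE q' p' hq' hp' h1' h2'
    -- Now `|E| ≤ |d|/2`, which improves the forced bound to `|e| ≥ 3|d|/2`.
    rw [h3'] at a' b' c'
    set e := (q : ℝ) * tau - p
    rcases lt_trichotomy d 0 with h0 | h0 | h0
    · have he : 0 < e := by nlinarith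
      rw [abs_of_pos he, abs_of_neg h0] at h4
      rw [abs_of_pos he, abs_le] at a
      rw [abs_of_neg (by linarith : d / 2 < 0), abs_le] at a'
      have : E < e := lt_of_le_of_ne a.2 (Ne.symm b)
      nlinarith
    · rw [h0] at h3
      simp at h3
    · have he : e < 0 := by nlinarith
      rw [abs_of_neg he, abs_of_pos h0] at h4
      rw [abs_of_neg he, abs_le] at a
      rw [abs_of_pos (by linarith : 0 < d / 2), abs_le] at a'
      have : e < E := lt_of_le_of_ne (by linarith) b
      nlinarith

end RoteFib
namespace RoteFib

/-! ### Beatty descriptions of the two words -/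

/-- The sequence `⌊n τ⌋`. -/
noncomputable def beatty (n : ℕ) : ℤ := ⌊(n : ℝ) * tau⌋

theorem beatty_nonneg (n : ℕ) : 0 ≤ beatty n :=
  Int.floor_nonneg.2 (mul_nonneg n.cast_nonneg (by linarith [lt_tau]))

theorem beatty_succ (n : ℕ) : beatty (n + 1) = beatty n ∨ beatty (n + 1) = beatty n + 1 := by
  have t1 := lt_tau
  have t2 := tau_lt
  have h1 : beatty n ≤ beatty (n + 1) := by
    apply Int.floor_le_floor
    push_cast
    linarith
  have h2 : beatty (n + 1) < beatty n + 2 := by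
    rw [beatty, Int.floor_lt]
    have := Int.lt_floor_add_one ((n : ℝ) * tau)
    push_cast [beatty]
    linarith
  omega

/-- The length of the image of the prefix of length `n` of the Fibonacci word. -/
noncomputable def imageLength (n : ℕ) : ℕ := n + (beatty (n + 1)).toNat

theorem imageLength_cast (n : ℕ) : (imageLength n : ℝ) = n + beatty (n + 1) := by
  have h : ((beatty (n + 1)).toNat : ℤ) = beatty (n + 1) := Int.toNat_of_nonneg (beatty_nonneg _)
  have h' : (((beatty (n + 1)).toNat : ℕ) : ℝ) = beatty (n + 1) := by exact_mod_cast h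
  rw [imageLength, Nat.cast_add, h']

theorem imageLength_zero : imageLength 0 = 0 := by
  have h : beatty 1 = 0 := by
    rw [beatty, Int.floor_eq_zero_iff]
    have t1 := lt_tau
    have t2 := tau_lt
    constructor <;> push_cast <;> linarith
  simp [imageLength, h]

theorem fract_bounds (n : ℕ) :
    0 < ((n + 1 : ℕ) : ℝ) * tau - beatty (n + 1) ∧
      ((n + 1 : ℕ) : ℝ) * tau - beatty (n + 1) < 1 := by
  constructor
  · refine lt_of_le_of_ne (sub_nonneg.2 (Int.floor_le _)) (Ne.symm (sub_ne_zero.2 ?_))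
    exact_mod_cast int_mul_tau_ne (q := (n + 1 : ℕ)) (by omega) (beatty (n + 1))
  · have := Int.lt_floor_add_one (((n + 1 : ℕ) : ℝ) * tau)
    rw [beatty]
    linarith

/-- Comes from `τ(1 + τ) = 1`; it reduces the floors at a block boundary to the fractional part of
`(n+1)τ`. -/
theorem imageLength_add_mul_tau (n k : ℕ) : ((imageLength n + k : ℕ) : ℝ) * tau =
    n + 1 + tau * (k - 1 - (((n + 1 : ℕ) : ℝ) * tau - beatty (n + 1))) := by
  push_cast
  rw [imageLength_cast]
  linear_combination ((n : ℝ) + 1) * tau_sq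

theorem beatty_imageLength_add_one (n : ℕ) : beatty (imageLength n + 1) = n := by
  rw [beatty, Int.floor_eq_iff, imageLength_add_mul_tau]
  obtain ⟨h1, h2⟩ := fract_bounds n
  have t1 := lt_tau
  have t2 := tau_lt
  push_cast at *
  constructor <;> nlinarith

theorem beatty_imageLength_add_two (n : ℕ) : beatty (imageLength n + 2) = n + 1 := by
  rw [beatty, Int.floor_eq_iff, imageLength_add_mul_tau]
  obtain ⟨h1, h2⟩ := fract_bounds n
  have t1 := lt_tau
  have t2 := tau_lt
  push_cast at *
  constructor <;> nlinarith

theorem beatty_imageLength_add_three (n : ℕ) (h : beatty (n + 2) = beatty (n + 1) + 1) :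
    beatty (imageLength n + 3) = n + 1 := by
  have h3 : (beatty (n + 1) : ℝ) + 1 ≤ (n + 2 : ℕ) * tau := by
    have := Int.floor_le (((n + 2 : ℕ) : ℝ) * tau)
    rw [beatty] at h
    rw [h] at this
    exact_mod_cast this
  rw [beatty, Int.floor_eq_iff, imageLength_add_mul_tau]
  obtain ⟨h1, h2⟩ := fract_bounds n
  have h4 := int_mul_tau_ne (q := (n + 2 : ℕ)) (by omega) (beatty (n + 1) + 1)
  have h5 : (beatty (n + 1) : ℝ) + 1 < (n + 2 : ℕ) * tau :=
    lt_of_le_of_ne h3 (Ne.symm (by exact_mod_cast h4))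
  have t1 := lt_tau
  have t2 := tau_lt
  have t3 := tau_sq
  push_cast at *
  constructor
  · nlinarith
  · have : tau * (3 - 1 - ((n + 1) * tau - beatty (n + 1))) < tau * (1 + tau) :=
      mul_lt_mul_of_pos_left (by linarith) (by linarith)
    linarith

/-! ### Identification of 𝐟 with a Sturmian word -/

/-- The Fibonacci word as a Sturmian word. -/
noncomputable def sturmFib : InfWord := fun n => if beatty (n + 2) = beatty (n + 1) + 1 then 0 else 1

/-- The Rote–Fibonacci word as the parity of a Beatty sequence. -/
noncomputable def parityWord : InfWord := fun n => if Even (beatty (n + 2)) then 1 else 0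

theorem InfWord.pref_succ (w : InfWord) (n : ℕ) : w.pref (n + 1) = w.pref n ++ [w n] := by
  simp [InfWord.pref, List.range_succ]

theorem InfWord.length_pref (w : InfWord) (n : ℕ) : (w.pref n).length = n := by
  simp [InfWord.pref]

theorem InfWord.getElem_pref (w : InfWord) (n i : ℕ) (h : i < (w.pref n).length) :
    (w.pref n)[i] = w i := by
  simp [InfWord.pref]

theorem imageLength_succ (n : ℕ) : imageLength (n + 1) =
    if beatty (n + 2) = beatty (n + 1) + 1 then imageLength n + 2 else imageLength n + 1 := by
  have h0 := beatty_nonneg (n + 1)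
  unfold imageLength
  rcases beatty_succ (n + 1) with h | h <;> rw [show n + 1 + 1 = n + 2 from rfl] at * <;>
    rw [h] <;> simp <;> omega

theorem sturmFib_imageLength (n : ℕ) : sturmFib (imageLength n) = 0 := by
  simp [sturmFib, beatty_imageLength_add_one, beatty_imageLength_add_two]

/-- Makes `sturmFib` a fixed point of the morphism, so that all `φᵏ(0)` are prefixes of it. -/
theorem phi_pref_sturmFib (n : ℕ) : phi (sturmFib.pref n) = sturmFib.pref (imageLength n) := by
  induction n with
  | zero => simp [imageLength_zero, InfWord.pref, phi]
  | succ n ih =>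
    have happ : phi (sturmFib.pref n ++ [sturmFib n])
        = phi (sturmFib.pref n) ++ phiLetter (sturmFib n) := by simp [phi]
    rw [InfWord.pref_succ, happ, ih, imageLength_succ]
    split_ifs with h
    · have h1 : sturmFib n = 0 := by simp [sturmFib, h]
      have h2 : sturmFib (imageLength n + 1) = 1 := by
        simp [sturmFib, beatty_imageLength_add_two, beatty_imageLength_add_three n h]
      rw [show imageLength n + 2 = imageLength n + 1 + 1 from rfl, InfWord.pref_succ,
        InfWord.pref_succ, sturmFib_imageLength, h2, h1]
      simp [phiLetter]
    · have h1 : sturmFib n = 1 := by simp [sturmFib, h]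
      rw [InfWord.pref_succ, sturmFib_imageLength, h1]
      simp [phiLetter]

theorem fibFinite_eq_pref (k : ℕ) : ∃ n, fibFinite k = sturmFib.pref n := by
  induction k with
  | zero =>
    refine ⟨1, ?_⟩
    have h := sturmFib_imageLength 0
    rw [imageLength_zero] at h
    simp [InfWord.pref, h, fibFinite]
  | succ k ih =>
    obtain ⟨n, hn⟩ := ih
    exact ⟨imageLength n, by rw [fibFinite_succ, hn, phi_pref_sturmFib]⟩

theorem fibWord_eq_sturmFib : fibWord = sturmFib := by
  funext k
  obtain ⟨n, hn⟩ := fibFinite_eq_pref k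
  simp only [fibWord, hn, InfWord.getElem_pref]

/-! ### Identification of 𝐫 with the parity word -/

theorem transduce_append_singleton (q : State) (x : Word) (a : Letter) :
    transduce q (x ++ [a]) = transduce q x ++ (State.next^[x.length] q).output a := by
  induction x generalizing q with
  | nil => simp [transduce]
  | cons b x ih => simp [transduce, ih]

theorem next_iterate (n : ℕ) : State.next^[n] .q0 = if Even n then State.q0 else State.q1 := by
  induction n with
  | zero => simp
  | succ n ih =>
    rw [Function.iterate_succ_apply', ih]
    by_cases h : Even n <;> simp [h, Nat.even_add_one, State.next]

theorem transduce_pref_sturmFib (n : ℕ) :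
    transduce .q0 (sturmFib.pref n) = parityWord.pref (imageLength n) := by
  induction n with
  | zero => simp [imageLength_zero, InfWord.pref, transduce]
  | succ n ih =>
    have h0 : parityWord (imageLength n) = if Even n then 0 else 1 := by
      by_cases hn : Even n <;>
        simp [parityWord, beatty_imageLength_add_two, hn]
    rw [InfWord.pref_succ, transduce_append_singleton, ih, imageLength_succ, InfWord.length_pref,
      next_iterate]
    split_ifs with h1 h2 h2
    all_goals
      first
      | rw [show imageLength n + 2 = imageLength n + 1 + 1 from rfl, InfWord.pref_succ,
          InfWord.pref_succ, h0]
        have h3 : parityWord (imageLength n + 1) = if Even n then 0 else 1 := by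
          simp [parityWord, beatty_imageLength_add_three n h2, h1]
        simp [h3, h1, sturmFib, h2, State.output]
      | rw [InfWord.pref_succ, h0]
        simp [h1, sturmFib, h2, State.output]

theorem roteFib_eq_parityWord : roteFib = parityWord := by
  funext n
  simp only [roteFib, transduceInf, fibWord_eq_sturmFib, transduce_pref_sturmFib,
    InfWord.getElem_pref]

theorem parityWord_eq_iff (i j : ℕ) :
    parityWord i = parityWord j ↔ (Even (beatty (i + 2)) ↔ Even (beatty (j + 2))) := by
  unfold parityWord
  split_ifs with h1 h2 h2 <;> simp [h1, h2]

/-! ### Aperiodicity -/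

theorem parityWord_not_ultimatelyPeriodic : ¬ parityWord.UltimatelyPeriodic := by
  rintro ⟨p, hp, N, h⟩
  simp only [parityWord_eq_iff] at h
  -- Increments are 0 or 1, so equal parities give equal increments.
  have hstep : ∀ i, beatty (N + 2 + p + i) - beatty (N + 2 + i)
      = beatty (N + 2 + p) - beatty (N + 2) := by
    intro i
    induction i with
    | zero => simp
    | succ i ih =>
      have e1 := h (N + i) (by omega)
      have e2 := h (N + i + 1) (by omega)
      rw [show N + i + p + 2 = N + 2 + p + i by ring, show N + i + 2 = N + 2 + i by ring] at e1
      rw [show N + i + 1 + p + 2 = N + 2 + p + i + 1 by ring,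
        show N + i + 1 + 2 = N + 2 + i + 1 by ring] at e2
      have s1 := beatty_succ (N + 2 + p + i)
      have s2 := beatty_succ (N + 2 + i)
      rw [← ih, ← add_assoc, ← add_assoc]
      rw [Int.even_iff, Int.even_iff] at e1 e2
      omega
  set c := beatty (N + 2 + p) - beatty (N + 2) with hc
  have hmul : ∀ k : ℕ, beatty (N + 2 + k * p) = beatty (N + 2) + k * c := by
    intro k
    induction k with
    | zero => simp
    | succ k ih =>
      have := hstep (k * p)
      rw [ih] at this
      rw [show N + 2 + (k + 1) * p = N + 2 + p + k * p by ring]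
      push_cast
      linarith
  have hne : (p : ℝ) * tau - c ≠ 0 :=
    sub_ne_zero.2 (by exact_mod_cast int_mul_tau_ne (q := p) (by omega) c)
  have hbound : ∀ k : ℕ, (k : ℝ) * |(p : ℝ) * tau - c| ≤ 1 := by
    intro k
    have a1 := Int.floor_le (((N + 2 : ℕ) : ℝ) * tau)
    have a2 := Int.lt_floor_add_one (((N + 2 : ℕ) : ℝ) * tau)
    have b1 := Int.floor_le (((N + 2 + k * p : ℕ) : ℝ) * tau)
    have b2 := Int.lt_floor_add_one (((N + 2 + k * p : ℕ) : ℝ) * tau)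
    have hk := hmul k
    unfold beatty at hk
    rw [hk] at b1 b2
    push_cast at a1 a2 b1 b2
    rw [← abs_of_nonneg (Nat.cast_nonneg (α := ℝ) k), ← abs_mul, abs_le]
    constructor <;> linarith
  obtain ⟨k, hk⟩ := exists_nat_gt (1 / |(p : ℝ) * tau - c|)
  rw [div_lt_iff₀ (abs_pos.2 hne)] at hk
  exact absurd (hbound k) (not_le.2 hk)

/-! ### Avoidance of `x x xᴿ` -/

theorem exists_even_near (z : ℝ) : ∃ m : ℤ, Even m ∧ |z - m| ≤ 1 := by
  refine ⟨2 * round (z / 2), even_two_mul _, ?_⟩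
  have h := abs_sub_round (z / 2)
  rw [abs_le] at h ⊢
  push_cast
  constructor <;> linarith

theorem exists_odd_near (z : ℝ) : ∃ m : ℤ, Odd m ∧ |z - m| ≤ 1 := by
  obtain ⟨m, hm, h⟩ := exists_even_near (z - 1)
  refine ⟨m + 1, hm.add_one, ?_⟩
  convert h using 2
  push_cast
  ring

theorem floor_eq_of_mem {z : ℝ} {a : ℤ} (h1 : 0 ≤ z) (h2 : z < 1) : ⌊(a : ℝ) + z⌋ = a := by
  rw [Int.floor_eq_iff]
  constructor <;> linarith

theorem floor_eq_of_neg {z : ℝ} {a : ℤ} (h1 : -1 ≤ z) (h2 : z < 0) : ⌊(a : ℝ) + z⌋ = a - 1 := by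
  rw [Int.floor_eq_iff]
  push_cast
  constructor <;> linarith

theorem beatty_of_approx {k : ℕ} {a : ℤ} {z : ℝ} (h : (k : ℝ) * tau = a + z) :
    (0 ≤ z → z < 1 → beatty k = a) ∧ (-1 ≤ z → z < 0 → beatty k = a - 1) := by
  rw [beatty, h]
  exact ⟨floor_eq_of_mem, floor_eq_of_neg⟩

/-- A square of period `n` followed by the reversal of its second half cannot occur in the
parities of a Beatty sequence; `K` is the position where the reversal starts. -/
theorem no_square_palindrome (n K : ℕ) (hn : 1 ≤ n) (hK : 2 * n < K)
    (hsq : ∀ s < n, (Even (beatty (K - 1 - s)) ↔ Even (beatty (K - 1 - s - n))))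
    (hpal : ∀ s < n, (Even (beatty (K + s)) ↔ Even (beatty (K - 1 - s)))) : False := by
  obtain ⟨m, hm, hmd⟩ := exists_even_near (n * tau)
  have hd : |(n : ℝ) * tau - m| < 1 := by
    refine lt_of_le_of_ne hmd fun h => ?_
    rcases (abs_eq zero_le_one).1 h with h | h
    · refine int_mul_tau_ne (q := n) (by omega) (m + 1) ?_
      push_cast
      linarith
    · refine int_mul_tau_ne (q := n) (by omega) (m - 1) ?_
      push_cast
      linarith
  -- `M` is odd so that `M + p = 2a` is even for odd `p`; the integers `a` and `a - p` near the
  -- mirrored multiples of `τ` then have opposite parity.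
  obtain ⟨M, hM, hMd⟩ := exists_odd_near ((2 * K - 1) * tau)
  refine odd_approx_obstruction n hn m hm hd ((2 * K - 1) * tau - M) ?_
  intro q p hq hp h1 h2
  obtain ⟨a, ha⟩ : Even (M + p) := hM.add_odd hp
  obtain ⟨j, rfl⟩ := hm
  obtain ⟨s', hs'⟩ := hq
  obtain ⟨p', hp'⟩ := hp
  obtain ⟨s, rfl⟩ : ∃ s : ℕ, s' = s := ⟨s'.toNat, by omega⟩
  have hs : s < n := by omega
  have hqR : (q : ℝ) = 2 * s + 1 := by exact_mod_cast hs'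
  have hMR : (M : ℝ) + p = a + a := by exact_mod_cast ha
  obtain ⟨L, rfl⟩ : ∃ L, K = L + 1 + s + n := ⟨K - 1 - s - n, by omega⟩
  specialize hsq s hs
  specialize hpal s hs
  rw [show L + 1 + s + n - 1 - s - n = L by omega] at hsq
  rw [show L + 1 + s + n - 1 - s = L + n by omega] at hsq hpal
  rw [abs_lt] at hd
  rw [abs_le] at hMd
  set E : ℝ := (2 * (L + 1 + s + n : ℕ) - 1) * tau - M with hE
  set e : ℝ := q * tau - p with he
  have c1 := beatty_of_approx (k := L + 1 + s + n + s) (a := a) (z := (E + e) / 2) (by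
    rw [hE, he, hqR]; push_cast; linarith)
  have c2 := beatty_of_approx (k := L + n) (a := a - p) (z := (E - e) / 2) (by
    rw [hE, he, hqR]; push_cast; linarith)
  have c3 := beatty_of_approx (k := L) (a := a - p - (j + j))
    (z := (E - e) / 2 - (n * tau - (j + j : ℤ))) (by
    rw [hE, he, hqR]; push_cast; linarith)
  set d : ℝ := n * tau - (j + j : ℤ) with hd_def
  rw [Int.even_iff, Int.even_iff] at hsq hpal
  have hne : ∀ (r b : ℤ), r ≠ 0 → (r : ℝ) * tau - b ≠ 0 :=
    fun r b hr => sub_ne_zero.2 (int_mul_tau_ne hr b)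
  have hsub : E - e ≠ 0 := by
    have := hne (2 * (L + 1 + s + n) - 1 - q) (M - p) (by omega)
    intro h
    apply this
    rw [← h, hE, he]
    push_cast
    ring
  have hadd : E + e ≠ 0 := by
    have := hne (2 * (L + 1 + s + n) - 1 + q) (M + p) (by omega)
    intro h
    apply this
    rw [← h, hE, he]
    push_cast
    ring
  refine ⟨?_, fun h => hsub (by rw [h]; ring), ?_⟩
  -- If `|e| < |E|`, both `(E ± e)/2` have the sign of `E`, so the mirrored floors differ by the odd
  -- `p`.
  · by_contra! hlt
    rcases lt_or_ge E 0 with h0 | h0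
    · rw [abs_of_neg h0, abs_lt] at hlt
      have e1 := c1.2 (by linarith) (by linarith)
      have e2 := c2.2 (by linarith) (by linarith)
      omega
    · rw [abs_of_nonneg h0, abs_lt] at hlt
      have e1 := c1.1 (by linarith) (by linarith)
      have e2 := c2.1 (by linarith) (by linarith)
      omega
  -- Otherwise `(E - e)/2` and `(E - e)/2 - d` have opposite signs, and floors at distance `n`
  -- differ in parity.
  · by_contra! hlt
    rcases lt_or_gt_of_ne hsub with h0 | h0
    · have h5 : 0 < e - E := by linarith
      have h6 : e - (E - 2 * d) < 0 := by
        by_contra! h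
        exact absurd (mul_nonneg h5.le h) (not_le.2 hlt)
      have e2 := c2.2 (by linarith) (by linarith)
      have e3 := c3.1 (by linarith) (by linarith)
      omega
    · have h5 : e - E < 0 := by linarith
      have h6 : 0 < e - (E - 2 * d) := by
        by_contra! h
        exact absurd (mul_nonneg_of_nonpos_of_nonpos h5.le h) (not_le.2 hlt)
      have e2 := c2.1 (by linarith) (by linarith)
      have e3 := c3.2 (by linarith) (by linarith)
      omega

theorem parityWord_avoidsXXXR : parityWord.AvoidsXXXR := by
  rintro x hx ⟨i, hi⟩
  set n := x.length with hn_def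
  have hn : 1 ≤ n := List.length_pos_iff.2 hx
  have hget : ∀ t (h : t < (x ++ x ++ x.reverse).length),
      parityWord (i + t) = (x ++ x ++ x.reverse)[t] := by
    intro t h
    have := List.getElem_of_eq hi (i := t) (by simpa using h)
    simpa using this
  have g1 : ∀ t (h : t < n), parityWord (i + t) = x[t] := by
    intro t h
    rw [hget t (by simp; omega), List.getElem_append_left (by simp; omega),
      List.getElem_append_left h]
  have g2 : ∀ t (h : t < n), parityWord (i + (n + t)) = x[t] := by
    intro t h
    rw [hget (n + t) (by simp; omega), List.getElem_append_left (by simp; omega),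
      List.getElem_append_right (by omega)]
    simp [hn_def]
  have g3 : ∀ t (h : t < n), parityWord (i + (2 * n + t)) = x[n - 1 - t] := by
    intro t h
    rw [hget (2 * n + t) (by simp; omega), List.getElem_append_right (by simp; omega),
      List.getElem_reverse]
    congr 1
    simp
    omega
  -- The `+ 2` is the index shift in `parityWord`.
  refine no_square_palindrome n (i + 2 * n + 2) hn (by omega) (fun s hs => ?_) fun s hs => ?_
  · have := (g2 (n - 1 - s) (by omega)).trans (g1 (n - 1 - s) (by omega)).symm
    rw [parityWord_eq_iff] at this
    rwa [show i + (n + (n - 1 - s)) + 2 = i + 2 * n + 2 - 1 - s by omega,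
      show i + (n - 1 - s) + 2 = i + 2 * n + 2 - 1 - s - n by omega] at this
  · have := (g3 s hs).trans (g2 (n - 1 - s) (by omega)).symm
    rw [parityWord_eq_iff] at this
    rwa [show i + (2 * n + s) + 2 = i + 2 * n + 2 + s by omega,
      show i + (n + (n - 1 - s)) + 2 = i + 2 * n + 2 - 1 - s by omega] at this

end RoteFib

theorem mainTheorem1 :
    RoteFib.roteFib.AvoidsXXXR ∧
    ¬ RoteFib.roteFib.UltimatelyPeriodic ∧
    ∃ w : RoteFib.InfWord, ¬ w.UltimatelyPeriodic ∧ w.AvoidsXXXR := by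
  rw [RoteFib.roteFib_eq_parityWord]
  exact ⟨RoteFib.parityWord_avoidsXXXR, RoteFib.parityWord_not_ultimatelyPeriodic,
    RoteFib.parityWord, RoteFib.parityWord_not_ultimatelyPeriodic, RoteFib.parityWord_avoidsXXXR⟩
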